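/- Let $G=(V,E)$ be a finite, simple, undirected, connected graph with weights $\omega_{ij}=\omega_{ji}\ge 0$, where $\omega_{ij}>0$ if and only if $ij\in E$ (so $\omega_{ii}=0$). Fix $r\in[0,1]$ and $\varepsilon>0$, and put $d_i:=\sum_{j}\omega_{ij}$. For $u,v:V\to\mathbb{R}$ let $$\langle u,v\rangle_{\mathcal V}:=\sum_{i\in V}u_iv_id_i^{\,r},\qquad \|u\|_{\mathcal V}:=\sqrt{\langle u,u\rangle_{\mathcal V}},\qquad (\Delta u)_i:=d_i^{-r}\sum_{j\in V}\omega_{ij}(u_i-u_j),\qquad \|\nabla u\|_{\mathcal E}^2:=\tfrac12\sum_{i,j\in V}\omega_{ij}(u_j-u_i)^2$$ (for the one-vertex graph with $r>0$, read $0^{\pm r}:=0$). Let $\mu:V\to[0,\infty)$ with $\mu\neq\mathbf 0$, let $\tilde f:V\to[0,1]$, and put $M:=\operatorname{diag}(\mu)$, $A:=\Delta+M$, $f:=M\tilde f$. Let $W(x):=\frac12x(1-x)$ for $x\in[0,1]$ and $W(x):=\infty$ otherwise, and $$\mathrm{GL}_{\mathrm{fid}}(u):=\tfrac12\|\nabla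 u\|_{\mathcal E}^2+\tfrac1\varepsilon\sum_{i\in V}W(u_i)\,d_i^{\,r}+\tfrac12\langle u-\tilde f,M(u-\tilde f)\rangle_{\mathcal V}.$$ Let $T=[0,\infty)$ or $T=[0,T_0]$ with $T_0>0$. Let $(u,\beta)$ be a solution on $T$ of the double-obstacle Allen–Cahn equation with fidelity forcing. That is, $u:T\to[0,1]^V$ is continuous and belongs to $H^1_{\mathrm{loc}}(T;\mathbb{R}^V)$, meaning that $u\in H^1((a,b);\mathbb{R}^V)$ for all $a,b\in T$; also $\beta:T\to\mathbb{R}^V$, and for almost every $t\in T$, with $\frac{du}{dt}$ the weak derivative, $$\varepsilon\frac{du}{dt}(t)+\varepsilon Au(t)-\varepsilon f+\tfrac12\mathbf 1-u(t)=\beta(t),\qquad \beta_i(t)\in-\partial I_{[0,1]}(u_i(t))\ \text{ for all } i\in V.$$ Here $\partial I_{[0,1]}$ is the subdifferential of the function equal to $0$ on $[0,1]$ and $\infty$ elsewhere; thus $\beta_i(t)\ge0$ if $u_i(t)=0$, $\beta_i(t)=0$ if $0<u_i(t)<1$, and $\beta_i(t)\le 0$ if $u_i(t)=1$. Suppose that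 $\varepsilon^{-1}$ is not an eigenvalue of $A$. Then $t\mapsto\mathrm{GL}_{\mathrm{fid}}(u(t))$ is finite and nonincreasing on $T$. More precisely, for all $s,t\in T$ with $s<t$, $$\mathrm{GL}_{\mathrm{fid}}(u(s))-\mathrm{GL}_{\mathrm{fid}}(u(t))\ \ge\ \frac{1}{2(t-s)}\,\|u(s)-u(t)\|_{\mathcal V}^2 .$$ Furthermore, for all $s,t\in T$, $$\|u(s)-u(t)\|_{\mathcal V}\le\sqrt{|t-s|}\,\sqrt{2\,\mathrm{GL}_{\mathrm{fid}}(u(0))}.$$ -/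

import Mathlib

namespace GraphACE

open MeasureTheory Set

open scoped ContDiff

noncomputable section

/-- A weighted graph: a simple, undirected, connected graph on `V` with symmetric nonnegative
weights `w i j` that are positive exactly on the edges (in particular `w i i = 0`). -/
structure WeightedGraph (V : Type*) extends SimpleGraph V where
  w : V → V → ℝ
  w_nonneg : ∀ i j, 0 ≤ w i j
  w_symm : ∀ i j, w i j = w j i
  w_pos_iff : ∀ i j, 0 < w i j ↔ Adj i j
  connected : toSimpleGraph.Connected

/-- The set of all `u : V → ℝ` with values in `X`. -/
def vertexFun (V : Type*) (X : Set ℝ) : Set (V → ℝ) := {u | ∀ i, u i ∈ X}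

section Graph

variable {V : Type*} [Fintype V] (G : WeightedGraph V)

/-- The degree `d i = ∑ j, w i j`. -/
def deg (i : V) : ℝ := ∑ j, G.w i j

/-- The inner product on vertex functions, `⟨u, v⟩ = ∑ i, u i * v i * (d i) ^ r`. -/
def vInner (r : ℝ) (u v : V → ℝ) : ℝ := ∑ i, u i * v i * deg G i ^ r

/-- The norm induced by `vInner`. -/
def vNorm (r : ℝ) (u : V → ℝ) : ℝ := Real.sqrt (vInner G r u u)

/-- The inner product on edge functions. Edge functions are written as functions of two vertices;
the weight is zero off the edges. -/
def eInner (p q : V → V → ℝ) : ℝ := (1 / 2) * ∑ i, ∑ j, p i j * q i j * G.w i j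

open Classical in
/-- The graph gradient. -/
def grad (u : V → ℝ) (i j : V) : ℝ := if G.Adj i j then u j - u i else 0

/-- The graph Laplacian `(Δ u) i = (d i) ^ (-r) * ∑ j, w i j * (u i - u j)`. -/
def lap (r : ℝ) : (V → ℝ) →ₗ[ℝ] (V → ℝ) where
  toFun u i := deg G i ^ (-r) * ∑ j, G.w i j * (u i - u j)
  map_add' u v := by
    funext i
    simp only [Pi.add_apply, ← mul_add, ← Finset.sum_add_distrib]
    congr 1
    exact Finset.sum_congr rfl fun j _ => by ring
  map_smul' c u := by
    funext i
    simp only [Pi.smul_apply, smul_eq_mul, RingHom.id_apply, Finset.mul_sum]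
    exact Finset.sum_congr rfl fun j _ => by ring

/-- The operator `M = diag(μ)`, that is `(M u) i = μ i * u i`. -/
def fidOp {V : Type*} (μ : V → ℝ) : (V → ℝ) →ₗ[ℝ] (V → ℝ) where
  toFun u i := μ i * u i
  map_add' u v := by
    funext i
    simp [mul_add]
  map_smul' c u := by
    funext i
    simp [mul_left_comm]

/-- The operator `A = Δ + M`. -/
def opA (r : ℝ) (μ : V → ℝ) : (V → ℝ) →ₗ[ℝ] (V → ℝ) := lap G r + fidOp μ

end Graph

/-- `σ(F)`, the set of eigenvalues of `F`. -/
def eigenvalueSet {V : Type*} (F : (V → ℝ) →ₗ[ℝ] (V → ℝ)) : Set ℝ :=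
  {l | Module.End.HasEigenvalue F l}

/-! ### The double-obstacle potential and the Ginzburg-Landau energy -/

open Classical in
/-- The double-obstacle potential: `x (1 - x) / 2` on `[0,1]` and `∞` elsewhere. -/
def obstacleW (x : ℝ) : EReal :=
  if x ∈ Icc (0 : ℝ) 1 then ((1 / 2 * x * (1 - x) : ℝ) : EReal) else ⊤

/-- The Ginzburg-Landau energy with fidelity,
`‖∇u‖² / 2 + ⟨W ∘ u, 1⟩ / ε + ⟨u - f', M (u - f')⟩ / 2`, with values in `(-∞, ∞]`; here `f'` is
the reference. The middle inner product is the sum defining `vInner`, taken in `EReal`. -/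
def energyFid {V : Type*} [Fintype V] (G : WeightedGraph V) (r ε : ℝ) (μ f' : V → ℝ)
    (u : V → ℝ) : EReal :=
  ((1 / 2 * eInner G (grad G u) (grad G u) : ℝ) : EReal)
    + ((1 / ε : ℝ) : EReal) * ∑ i, obstacleW (u i) * ((deg G i ^ r : ℝ) : EReal)
    + ((1 / 2 * vInner G r (u - f') (fidOp μ (u - f')) : ℝ) : EReal)

/-! ### The subdifferential of the obstacle -/

open Classical in
/-- The convex indicator function of `[0,1]`. -/
def indic01 (x : ℝ) : EReal := if x ∈ Icc (0 : ℝ) 1 then 0 else ⊤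

/-- The subdifferential at `x` of an extended-real valued function `g` on the line. -/
def subdiff (g : ℝ → EReal) (x : ℝ) : Set ℝ :=
  {p | g x ≠ ⊤ ∧ ∀ y : ℝ, g x + ((p * (y - x) : ℝ) : EReal) ≤ g y}

/-- The set `𝓑(u)` of all `α` with `α i ∈ -∂I(u i)` at each vertex, `I` the indicator of `[0,1]`. -/
def obstacleB {V : Type*} (u : V → ℝ) : Set (V → ℝ) :=
  {α | ∀ i, -(α i) ∈ subdiff indic01 (u i)}

/-- The explicit form of `𝓑(u)`. -/
theorem mem_obstacleB_iff {V : Type*} (u α : V → ℝ) :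
    α ∈ obstacleB u ↔ ∀ i, u i ∈ Icc (0 : ℝ) 1 ∧ (u i = 0 → 0 ≤ α i) ∧
      (0 < u i ∧ u i < 1 → α i = 0) ∧ (u i = 1 → α i ≤ 0) := by
  have key : ∀ x p : ℝ, -p ∈ subdiff indic01 x ↔
      x ∈ Icc (0 : ℝ) 1 ∧ ∀ y ∈ Icc (0 : ℝ) 1, 0 ≤ p * (y - x) := by
    intro x p
    constructor
    · rintro ⟨h1, h2⟩
      have hx : x ∈ Icc (0 : ℝ) 1 := by
        by_contra hx
        exact h1 (by simp [indic01, hx])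
      refine ⟨hx, fun y hy => ?_⟩
      have h := h2 y
      simp only [indic01, if_pos hx, if_pos hy, zero_add] at h
      have h' : -p * (y - x) ≤ 0 := by exact_mod_cast h
      linarith
    · rintro ⟨hx, h⟩
      refine ⟨by simp only [indic01, if_pos hx]; exact EReal.zero_ne_top, fun y => ?_⟩
      by_cases hy : y ∈ Icc (0 : ℝ) 1
      · simp only [indic01, if_pos hx, if_pos hy, zero_add]
        have := h y hy
        have h' : -p * (y - x) ≤ 0 := by linarith
        exact_mod_cast h'
      · simp only [indic01, if_neg hy]
        exact le_top
  refine forall_congr' fun i => ?_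
  rw [key]
  generalize u i = x
  generalize α i = p
  refine and_congr_right fun hx => ?_
  constructor
  · intro h
    have h0 := h 0 (by simp)
    have h1 := h 1 (by simp)
    refine ⟨?_, ?_, ?_⟩
    · rintro rfl
      linarith
    · rintro ⟨ha, hb⟩
      apply le_antisymm <;> nlinarith
    · rintro rfl
      linarith
  · rintro ⟨h0, hm, h1⟩ y hy
    rcases hx.1.eq_or_lt with hx0 | hx0
    · have := h0 hx0.symm
      exact mul_nonneg this (by linarith [hy.1])
    rcases hx.2.eq_or_lt with hx1 | hx1
    · have := h1 hx1
      exact mul_nonneg_of_nonpos_of_nonpos this (by linarith [hy.2])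
    · simp [hm ⟨hx0, hx1⟩]

/-! ### Sobolev regularity in time and the Allen-Cahn equation

Functions of time are total functions on the line; only their values on the time interval `T`
matter. -/

/-- `u ∈ L²((a,b))`, for a function with values in the finite-dimensional space `V → ℝ`. -/
def MemL2 {V : Type*} (a b : ℝ) (u : ℝ → V → ℝ) : Prop :=
  ∀ i, MemLp (fun t => u t i) 2 (volume.restrict (Ioo a b))

/-- `v` is a weak derivative of `u` on `(a,b)`, tested against all smooth functions
`φ : (a,b) → (V → ℝ)` with compact support in `(a,b)`. -/
def IsWeakDeriv {V : Type*} [Fintype V] (G : WeightedGraph V) (r a b : ℝ)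
    (u v : ℝ → V → ℝ) : Prop :=
  ∀ φ : ℝ → V → ℝ, ContDiff ℝ ∞ φ → HasCompactSupport φ → tsupport φ ⊆ Ioo a b →
    ∫ t in Ioo a b, vInner G r (u t) (deriv φ t) = -∫ t in Ioo a b, vInner G r (v t) (φ t)

/-- `u` belongs to `H¹_loc(T)`, i.e. to `H¹((a,b))` for all `a, b ∈ T`, with weak derivative
`v`. -/
def HasH1locDeriv {V : Type*} [Fintype V] (G : WeightedGraph V) (r : ℝ) (T : Set ℝ)
    (u v : ℝ → V → ℝ) : Prop :=
  ∀ a ∈ T, ∀ b ∈ T, MemL2 a b u ∧ MemL2 a b v ∧ IsWeakDeriv G r a b u v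

/-- `(u, β)` is a solution on `T` of the double-obstacle Allen-Cahn equation with fidelity
forcing, for the parameter `μ` and the reference `f'` (so that `f = M f'`): `u` is continuous, in
`H¹_loc(T)`, with values in `[0,1]`, and for almost every `t ∈ T`
`ε u'(t) + ε A u(t) - ε f + 1/2 - u(t) = β(t) ∈ 𝓑(u(t))`, with `u'` the weak derivative. -/
def IsACESolution {V : Type*} [Fintype V] (G : WeightedGraph V) (r ε : ℝ) (μ f' : V → ℝ)
    (T : Set ℝ) (u β : ℝ → V → ℝ) : Prop :=
  (∀ t ∈ T, u t ∈ vertexFun V (Icc 0 1)) ∧ ContinuousOn u T ∧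
    ∃ u' : ℝ → V → ℝ, HasH1locDeriv G r T u u' ∧
      ∀ᵐ t ∂(volume.restrict T),
        ε • u' t + ε • opA G r μ (u t) - ε • fidOp μ f' + (fun _ => (1 / 2 : ℝ)) - u t = β t ∧
          β t ∈ obstacleB (u t)

end

end GraphACE

/-!
Since `u` is continuous, its weak derivative exhibits it as an absolutely continuous function, which
has derivative `u'` almost everywhere. Dividing the Allen-Cahn equation by `ε` says that the
`vInner`-gradient of the energy at `u` is `β / ε - u'`. The subdifferential condition on `β` is the
variational inequality `β i * (y i - u i) ≥ 0` for all `y` with values in `[0,1]`; as `u` itself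
stays in `[0,1]`, the function `⟨β t, u ·⟩` is minimal at `t`, so that `⟨β, u'⟩ = 0` almost
everywhere. Hence the energy is absolutely continuous with derivative `-‖u'‖²`, and integrating this
from `s` to `t` and applying the Cauchy-Schwarz inequality in time bounds `‖u s - u t‖²` by `t - s`
times the energy drop.
-/

namespace GraphACE

open MeasureTheory Set

open scoped ContDiff

/-! ### Absolutely continuous functions and weak derivatives -/

section AbsoluteContinuity

variable {a b : ℝ}

theorem absolutelyContinuousOnInterval_of_dist_le {X Y : Type*} [PseudoMetricSpace X]
    [PseudoMetricSpace Y] {f : ℝ → X} {g : ℝ → Y} {K : ℝ}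
    (hg : AbsolutelyContinuousOnInterval g a b)
    (hfg : ∀ x ∈ uIcc a b, ∀ y ∈ uIcc a b, dist (f x) (f y) ≤ K * dist (g x) (g y)) :
    AbsolutelyContinuousOnInterval f a b := by
  have hKg := Filter.Tendsto.const_mul K hg
  rw [mul_zero] at hKg
  refine squeeze_zero' (.of_forall fun E => Finset.sum_nonneg fun _ _ => dist_nonneg) ?_ hKg
  refine Filter.eventually_inf_principal.mpr (.of_forall fun E hE => ?_)
  rw [Finset.mul_sum]
  exact Finset.sum_le_sum fun i hi => hfg _ (hE.1 i hi).1 _ (hE.1 i hi).2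

variable {E F : Type*} [NormedAddCommGroup E] [NormedSpace ℝ E] [NormedAddCommGroup F]
  [NormedSpace ℝ F]

theorem absolutelyContinuousOnInterval_contDiff_comp {f : E → F} {u : ℝ → E}
    (hf : ContDiff ℝ 1 f) (hu : AbsolutelyContinuousOnInterval u a b) :
    AbsolutelyContinuousOnInterval (fun x => f (u x)) a b := by
  obtain ⟨K, hK⟩ := hf.locallyLipschitz.locallyLipschitzOn.exists_lipschitzOnWith_of_compact
    (isCompact_uIcc.image_of_continuousOn hu.continuousOn)
  exact absolutelyContinuousOnInterval_of_dist_le hu fun x hx y hy =>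
    hK.dist_le_mul _ (mem_image_of_mem u hx) _ (mem_image_of_mem u hy)

theorem absolutelyContinuousOnInterval_of_eq_add_integral {u v : ℝ → E}
    (hv : IntervalIntegrable v volume a b)
    (huv : ∀ x ∈ uIcc a b, u x = u a + ∫ t in a..x, v t) :
    AbsolutelyContinuousOnInterval u a b := by
  have hnorm := hv.norm.absolutelyContinuousOnInterval_intervalIntegral left_mem_uIcc
  have hint : ∀ x ∈ uIcc a b, IntervalIntegrable v volume a x := fun x hx =>
    hv.mono_set (uIcc_subset_uIcc_left hx)
  refine absolutelyContinuousOnInterval_of_dist_le (K := 1) hnorm fun x hx y hy => ?_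
  rw [huv x hx, huv y hy, dist_add_left, dist_eq_norm, one_mul, Real.dist_eq,
    intervalIntegral.integral_interval_sub_left (hint x hx) (hint y hy),
    intervalIntegral.integral_interval_sub_left (hint x hx).norm (hint y hy).norm]
  exact intervalIntegral.norm_integral_le_abs_integral_norm

theorem ae_hasDerivAt_of_eq_add_integral [CompleteSpace E] {u v : ℝ → E} (hab : a ≤ b)
    (hv : IntervalIntegrable v volume a b)
    (huv : ∀ x ∈ Icc a b, u x = u a + ∫ t in a..x, v t) :
    ∀ᵐ x, x ∈ Ioo a b → HasDerivAt u (v x) x := by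
  filter_upwards [hv.ae_hasDerivAt_integral] with x hderiv hx
  rw [uIcc_of_le hab] at hderiv
  refine ((hderiv (Ioo_subset_Icc_self hx) a (left_mem_Icc.mpr hab)).const_add
    (u a)).congr_of_eventuallyEq ?_
  filter_upwards [isOpen_Ioo.mem_nhds hx] with y hy using huv y (Ioo_subset_Icc_self hy)

theorem integral_eq_sub_of_ae_hasDerivAt [CompleteSpace E] {u v : ℝ → E} (hab : a ≤ b)
    (hu : AbsolutelyContinuousOnInterval u a b) (hv : IntervalIntegrable v volume a b)
    (huv : ∀ᵐ x, x ∈ Ioo a b → HasDerivAt u (v x) x) :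
    ∫ x in a..b, v x = u b - u a := by
  set P : ℝ → E := fun x => ∫ t in a..x, v t
  have hP : ∀ x ∈ Icc a b, P x = P a + ∫ t in a..x, v t := fun x _ => by simp [P]
  have hPac : AbsolutelyContinuousOnInterval P a b :=
    absolutelyContinuousOnInterval_of_eq_add_integral hv (by rwa [uIcc_of_le hab])
  have hderiv : ∀ᵐ x, x ∈ uIcc a b → HasDerivAt (u - P) 0 x := by
    have hIoo : ∀ᵐ x : ℝ, x ∈ Icc a b → x ∈ Ioo a b := by
      filter_upwards [Ioo_ae_eq_Icc (a := a) (b := b) (μ := volume)] with x hx using hx.mpr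
    rw [uIcc_of_le hab]
    filter_upwards [hIoo, huv, ae_hasDerivAt_of_eq_add_integral hab hv hP] with x hx hux hPx hxab
    simpa using (hux (hx hxab)).sub (hPx (hx hxab))
  obtain ⟨c, hc⟩ := (hu.sub hPac).const_of_ae_hasDerivAt_zero hderiv
  have hca := hc a left_mem_uIcc
  have hcb := hc b right_mem_uIcc
  simp only [Pi.sub_apply, P, intervalIntegral.integral_same, sub_zero] at hca hcb
  rw [hca, ← hcb, sub_sub_cancel]

end AbsoluteContinuity

/-- `v` is a weak derivative of `u` on `(a, b)`, for functions with values in a normed space and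
tested against scalar functions. This is the coordinate-free form of `IsWeakDeriv`. -/
def HasWeakDeriv {E : Type*} [NormedAddCommGroup E] [NormedSpace ℝ E] (a b : ℝ) (u v : ℝ → E) :
    Prop :=
  ∀ ψ : ℝ → ℝ, ContDiff ℝ ∞ ψ → HasCompactSupport ψ → tsupport ψ ⊆ Ioo a b →
    ∫ t in Ioo a b, deriv ψ t • u t = -∫ t in Ioo a b, ψ t • v t

section WeakDerivative

variable {E : Type*} [NormedAddCommGroup E] [NormedSpace ℝ E] {a b : ℝ} {u v : ℝ → E}

theorem exists_contDiff_primitive [CompleteSpace E] {k : ℝ → E} (hk : ContDiff ℝ ∞ k)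
    (hk_cpt : HasCompactSupport k) (hk_supp : tsupport k ⊆ Ioo a b) (hk_int : ∫ x, k x = 0) :
    ∃ ψ : ℝ → E, ContDiff ℝ ∞ ψ ∧ HasCompactSupport ψ ∧ tsupport ψ ⊆ Ioo a b ∧ deriv ψ = k := by
  rcases (tsupport k).eq_empty_or_nonempty with hempty | hne
  · obtain rfl : k = 0 := tsupport_eq_empty_iff.mp hempty
    exact ⟨0, contDiff_const, .zero, by simp [tsupport], by ext; simp⟩
  obtain ⟨c, hc, hc_le⟩ := hk_cpt.isCompact.exists_isLeast hne
  obtain ⟨d, hd, hd_ge⟩ := hk_cpt.isCompact.exists_isGreatest hne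
  set ψ : ℝ → E := fun x => ∫ t in a..x, k t
  have hderiv : ∀ x, HasDerivAt ψ (k x) x := fun x =>
    intervalIntegral.integral_hasDerivAt_right (hk.continuous.intervalIntegrable _ _)
      (hk.continuous.stronglyMeasurableAtFilter _ _) hk.continuous.continuousAt
  have hψ_deriv : deriv ψ = k := funext fun x => (hderiv x).deriv
  have hzero_left : ∀ x < c, ψ x = 0 := fun x hx => by
    refine intervalIntegral.integral_zero_ae (.of_forall fun y hy => ?_)
    exact image_eq_zero_of_notMem_tsupport fun hy' =>
      (hy.2.trans_lt (max_lt (hk_supp hc).1 hx)).not_ge (hc_le hy')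
  have hzero_right : ∀ x, d < x → ψ x = 0 := fun x hx => by
    refine (intervalIntegral.integral_eq_integral_of_support_subset fun y hy => ?_).trans hk_int
    exact ⟨(hk_supp (subset_tsupport k hy)).1, (hd_ge (subset_tsupport k hy)).trans hx.le⟩
  have hsupp : Function.support ψ ⊆ Icc c d := fun x hx =>
    ⟨not_lt.mp fun h => hx (hzero_left x h), not_lt.mp fun h => hx (hzero_right x h)⟩
  refine ⟨ψ, contDiff_infty_iff_deriv.mpr ⟨fun x => (hderiv x).differentiableAt, by rwa [hψ_deriv]⟩,
    .of_support_subset_isCompact isCompact_Icc hsupp,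
    (closure_minimal hsupp isClosed_Icc).trans (Icc_subset_Ioo (hk_supp hc).1 (hk_supp hd).2),
    hψ_deriv⟩

theorem exists_contDiff_integral_eq_one (hab : a < b) :
    ∃ η : ℝ → ℝ, ContDiff ℝ ∞ η ∧ HasCompactSupport η ∧ tsupport η ⊆ Ioo a b ∧ ∫ x, η x = 1 := by
  let η : ContDiffBump ((a + b) / 2) := ⟨(b - a) / 8, (b - a) / 4, by linarith, by linarith⟩
  refine ⟨η.normed volume, η.contDiff_normed, η.hasCompactSupport_normed, ?_, η.integral_normed⟩
  rw [η.tsupport_normed_eq, Real.closedBall_eq_Icc]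
  apply Icc_subset_Ioo <;> simp only [η] <;> linarith

theorem exists_contDiff_deriv_eq_sub {g η : ℝ → ℝ}
    (hg : ContDiff ℝ ∞ g) (hg_cpt : HasCompactSupport g) (hg_supp : tsupport g ⊆ Ioo a b)
    (hη : ContDiff ℝ ∞ η) (hη_cpt : HasCompactSupport η) (hη_supp : tsupport η ⊆ Ioo a b)
    (hη_int : ∫ x, η x = 1) :
    ∃ ψ : ℝ → ℝ, ContDiff ℝ ∞ ψ ∧ HasCompactSupport ψ ∧ tsupport ψ ⊆ Ioo a b ∧
      deriv ψ = fun x => g x - (∫ y, g y) * η x := by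
  have hcη_supp : tsupport (fun x => (∫ y, g y) * η x) ⊆ Ioo a b :=
    (closure_mono (Function.support_mul_subset_right _ _)).trans hη_supp
  refine exists_contDiff_primitive (hg.sub (contDiff_const.mul hη)) (hg_cpt.sub hη_cpt.mul_left)
    ((tsupport_sub _ _).trans (union_subset hg_supp hcη_supp)) ?_
  rw [integral_sub (hg.continuous.integrable_of_hasCompactSupport hg_cpt)
    ((hη.continuous.integrable_of_hasCompactSupport hη_cpt).const_mul _),
    integral_const_mul, hη_int, mul_one, sub_self]

theorem setIntegral_smul_eq_integral {ψ : ℝ → ℝ} {s : Set ℝ} (hψ : tsupport ψ ⊆ s) (f : ℝ → E) :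
    ∫ x in s, ψ x • f x = ∫ x, ψ x • f x :=
  setIntegral_eq_integral_of_forall_compl_eq_zero fun x hx => by
    rw [image_eq_zero_of_notMem_tsupport fun h => hx (hψ h), zero_smul]

theorem integrableOn_smul_of_hasCompactSupport {ψ : ℝ → ℝ} {s : Set ℝ} (hu : IntegrableOn u s)
    (hψ : Continuous ψ) (hψ_cpt : HasCompactSupport ψ) :
    IntegrableOn (fun x => ψ x • u x) s :=
  hu.integrable.locallyIntegrable.integrable_smul_left_of_hasCompactSupport hψ hψ_cpt

namespace HasWeakDeriv

theorem sub {u₁ u₂ v₁ v₂ : ℝ → E} (h₁ : HasWeakDeriv a b u₁ v₁) (h₂ : HasWeakDeriv a b u₂ v₂)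
    (hu₁ : IntegrableOn u₁ (Ioo a b)) (hu₂ : IntegrableOn u₂ (Ioo a b))
    (hv₁ : IntegrableOn v₁ (Ioo a b)) (hv₂ : IntegrableOn v₂ (Ioo a b)) :
    HasWeakDeriv a b (u₁ - u₂) (v₁ - v₂) := by
  intro ψ hψ hψ_cpt hψ_supp
  have hderiv := fun {w : ℝ → E} (hw : IntegrableOn w (Ioo a b)) =>
    integrableOn_smul_of_hasCompactSupport hw (hψ.continuous_deriv (by simp)) hψ_cpt.deriv
  have hval := fun {w : ℝ → E} (hw : IntegrableOn w (Ioo a b)) =>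
    integrableOn_smul_of_hasCompactSupport hw hψ.continuous hψ_cpt
  simp only [Pi.sub_apply, smul_sub]
  rw [integral_sub (hderiv hu₁) (hderiv hu₂), integral_sub (hval hv₁) (hval hv₂),
    h₁ ψ hψ hψ_cpt hψ_supp, h₂ ψ hψ hψ_cpt hψ_supp]
  abel

/-- The lemma of du Bois-Reymond. -/
theorem ae_eq_const [CompleteSpace E] (hab : a < b) (h : HasWeakDeriv a b u 0)
    (hu : IntegrableOn u (Ioo a b)) : ∃ c, ∀ᵐ x ∂volume.restrict (Ioo a b), u x = c := by
  obtain ⟨η, hη, hη_cpt, hη_supp, hη_int⟩ := exists_contDiff_integral_eq_one hab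
  refine ⟨∫ x in Ioo a b, η x • u x, ?_⟩
  set c := ∫ x in Ioo a b, η x • u x
  have hconst : IntegrableOn (fun _ => c) (Ioo a b) := integrableOn_const (by simp)
  suffices ∀ᵐ x, x ∈ Ioo a b → u x - c = 0 by
    rw [ae_restrict_iff' measurableSet_Ioo]
    filter_upwards [this] with x hx hxab using sub_eq_zero.mp (hx hxab)
  refine isOpen_Ioo.ae_eq_zero_of_integral_contDiff_smul_eq_zero
    (hu.sub hconst).locallyIntegrableOn fun g hg hg_cpt hg_supp => ?_
  obtain ⟨ψ, hψ, hψ_cpt, hψ_supp, hψ_deriv⟩ :=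
    exists_contDiff_deriv_eq_sub hg hg_cpt hg_supp hη hη_cpt hη_supp hη_int
  have hgu := integrableOn_smul_of_hasCompactSupport hu hg.continuous hg_cpt
  have hηu := integrableOn_smul_of_hasCompactSupport hu hη.continuous hη_cpt
  have hcηu : IntegrableOn (fun x => (∫ y, g y) • η x • u x) (Ioo a b) := hηu.smul _
  have hg_int : ∫ x in Ioo a b, g x = ∫ x, g x := by
    simpa using setIntegral_smul_eq_integral hg_supp (fun _ => (1 : ℝ))
  have hψ_weak : (∫ x in Ioo a b, g x • u x) - (∫ y, g y) • c = 0 := by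
    have := h ψ hψ hψ_cpt hψ_supp
    simp only [hψ_deriv, sub_smul, mul_smul, Pi.zero_apply, smul_zero, integral_zero,
      neg_zero] at this
    rwa [integral_sub hgu hcηu, integral_smul] at this
  calc ∫ x, g x • (u x - c) = ∫ x in Ioo a b, (g x • u x - g x • c) := by
        simp only [← smul_sub, setIntegral_smul_eq_integral hg_supp]
    _ = (∫ x in Ioo a b, g x • u x) - ∫ x in Ioo a b, g x • c :=
        integral_sub hgu (integrableOn_smul_of_hasCompactSupport hconst hg.continuous hg_cpt)
    _ = 0 := by rw [integral_smul_const, hg_int, hψ_weak]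

theorem eqOn_const [CompleteSpace E] (hab : a < b) (h : HasWeakDeriv a b u 0)
    (hu : ContinuousOn u (Icc a b)) : ∃ c, EqOn u (fun _ => c) (Icc a b) := by
  obtain ⟨c, hc⟩ := h.ae_eq_const hab (hu.integrableOn_Icc.mono_set Ioo_subset_Icc_self)
  have hIoo : EqOn u (fun _ => c) (Ioo a b) :=
    Measure.eqOn_open_of_ae_eq hc isOpen_Ioo (hu.mono Ioo_subset_Icc_self) continuousOn_const
  exact ⟨c, hIoo.of_subset_closure hu continuousOn_const Ioo_subset_Icc_self
    (closure_Ioo hab.ne).ge⟩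

end HasWeakDeriv

theorem hasWeakDeriv_of_eq_add_integral [CompleteSpace E] (hab : a ≤ b)
    (hv : IntervalIntegrable v volume a b)
    (huv : ∀ x ∈ Icc a b, u x = u a + ∫ t in a..x, v t) : HasWeakDeriv a b u v := by
  intro ψ hψ _ hψ_supp
  have huac : AbsolutelyContinuousOnInterval u a b :=
    absolutelyContinuousOnInterval_of_eq_add_integral hv (by rwa [uIcc_of_le hab])
  have hψac : AbsolutelyContinuousOnInterval ψ a b :=
    (hψ.of_le (by simp)).contDiffOn.absolutelyContinuousOnInterval
  have hψ_deriv : Continuous (deriv ψ) := hψ.continuous_deriv (by simp)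
  have hderiv : ∀ᵐ x, x ∈ Ioo a b →
      HasDerivAt (fun x => ψ x • u x) (ψ x • v x + deriv ψ x • u x) x := by
    filter_upwards [ae_hasDerivAt_of_eq_add_integral hab hv huv] with x hx hxab
    exact ((hψ.differentiable (by simp) x).hasDerivAt).smul (hx hxab)
  have hint₁ : IntervalIntegrable (fun x => ψ x • v x) volume a b :=
    hv.continuousOn_smul hψ.continuous.continuousOn
  have hint₂ : IntervalIntegrable (fun x => deriv ψ x • u x) volume a b :=
    (hψ_deriv.continuousOn.smul huac.continuousOn).intervalIntegrable
  have hψ_zero : ∀ x ∉ Ioo a b, ψ x = 0 := fun x hx =>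
    image_eq_zero_of_notMem_tsupport fun h => hx (hψ_supp h)
  have hparts := integral_eq_sub_of_ae_hasDerivAt hab (hψac.fun_smul huac) (hint₁.add hint₂) hderiv
  rw [intervalIntegral.integral_add hint₁ hint₂, hψ_zero a (by simp), hψ_zero b (by simp),
    zero_smul, zero_smul, sub_self] at hparts
  simp only [intervalIntegral.integral_of_le hab, integral_Ioc_eq_integral_Ioo] at hparts
  exact eq_neg_of_add_eq_zero_right hparts

theorem HasWeakDeriv.eq_add_integral [CompleteSpace E] (hab : a < b) (h : HasWeakDeriv a b u v)
    (hu : ContinuousOn u (Icc a b)) (hv : IntervalIntegrable v volume a b) :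
    ∀ x ∈ Icc a b, u x = u a + ∫ t in a..x, v t := by
  set P : ℝ → E := fun x => ∫ t in a..x, v t
  have hP : ∀ x ∈ Icc a b, P x = P a + ∫ t in a..x, v t := fun x _ => by simp [P]
  have hP_cont : ContinuousOn P (Icc a b) := by
    rw [← uIcc_of_le hab.le] at hP ⊢
    exact (absolutelyContinuousOnInterval_of_eq_add_integral hv hP).continuousOn
  have hIoo : ∀ {w : ℝ → E}, ContinuousOn w (Icc a b) → IntegrableOn w (Ioo a b) := fun hw =>
    hw.integrableOn_Icc.mono_set Ioo_subset_Icc_self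
  have hv_Ioo := (intervalIntegrable_iff_integrableOn_Ioo_of_le hab.le).mp hv
  have hsub := h.sub (hasWeakDeriv_of_eq_add_integral hab.le hv hP) (hIoo hu) (hIoo hP_cont)
    hv_Ioo hv_Ioo
  rw [sub_self] at hsub
  obtain ⟨c, hc⟩ := hsub.eqOn_const hab (hu.sub hP_cont)
  intro x hx
  have hcx := hc hx
  have hca := hc (left_mem_Icc.mpr hab.le)
  simp only [Pi.sub_apply, P, intervalIntegral.integral_same, sub_zero] at hcx hca
  rw [hca, ← hcx, sub_add_cancel]

end WeakDerivative

theorem sq_intervalIntegral_le_mul_integral_sq {a b : ℝ} (hab : a < b) {v : ℝ → ℝ}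
    (hv : IntervalIntegrable v volume a b)
    (hv_sq : IntervalIntegrable (fun t => v t ^ 2) volume a b) :
    (∫ t in a..b, v t) ^ 2 ≤ (b - a) * ∫ t in a..b, v t ^ 2 := by
  have hba : 0 < b - a := sub_pos.mpr hab
  have hjensen : (⨍ t in a..b, v t) ^ 2 ≤ ⨍ t in a..b, v t ^ 2 := by
    rw [uIoc_of_le hab.le]
    exact (even_two.convexOn_pow (𝕜 := ℝ)).map_set_average_le (continuousOn_pow 2) isClosed_univ
      (by simp [hab]) (by simp) (by simp) hv.1 hv_sq.1
  rw [interval_average_eq_div, interval_average_eq_div, div_pow,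
    div_le_div_iff₀ (by positivity) hba] at hjensen
  nlinarith

/-! ### Graph calculus and the gradient of the energy -/

theorem w_eq_zero_of_not_adj {V : Type*} {G : WeightedGraph V} {i j : V}
    (h : ¬ G.Adj i j) : G.w i j = 0 :=
  (not_lt.mp (mt (G.w_pos_iff i j).mp h)).antisymm (G.w_nonneg i j)

section Graph

variable {V : Type*} [Fintype V] (G : WeightedGraph V) (r ε : ℝ) (μ f' : V → ℝ)

theorem deg_nonneg (i : V) : 0 ≤ deg G i := Finset.sum_nonneg fun j _ => G.w_nonneg i j

theorem deg_rpow_nonneg (i : V) : 0 ≤ deg G i ^ r := Real.rpow_nonneg (deg_nonneg G i) r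

variable {G r} in
theorem w_eq_zero_of_deg_rpow_eq_zero {i : V} (h : deg G i ^ r = 0) (j : V) : G.w i j = 0 := by
  have hdeg : deg G i = 0 := ((Real.rpow_eq_zero_iff_of_nonneg (deg_nonneg G i)).mp h).1
  exact (Finset.sum_eq_zero_iff_of_nonneg fun j _ => G.w_nonneg i j).mp hdeg j (Finset.mem_univ j)

variable {G r} in
theorem subsingleton_of_deg_rpow_eq_zero {i : V} (h : deg G i ^ r = 0) : Subsingleton V := by
  by_contra hV
  rw [not_subsingleton_iff_nontrivial] at hV
  obtain ⟨j, hij⟩ := G.connected.preconnected.exists_adj_of_nontrivial i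
  exact ((G.w_pos_iff i j).mpr hij).ne' (w_eq_zero_of_deg_rpow_eq_zero h j)

theorem vInner_comm (u v : V → ℝ) : vInner G r u v = vInner G r v u := by
  simp only [vInner, mul_comm]

theorem vInner_sub_left (u v x : V → ℝ) :
    vInner G r (u - v) x = vInner G r u x - vInner G r v x := by
  simp only [vInner, Pi.sub_apply, sub_mul, Finset.sum_sub_distrib]

theorem vInner_add_left (u v x : V → ℝ) :
    vInner G r (u + v) x = vInner G r u x + vInner G r v x := by
  simp only [vInner, Pi.add_apply, add_mul, Finset.sum_add_distrib]

theorem vInner_smul_left (c : ℝ) (u v : V → ℝ) : vInner G r (c • u) v = c * vInner G r u v := by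
  simp only [vInner, Pi.smul_apply, smul_eq_mul, mul_assoc, Finset.mul_sum]

theorem vInner_self_nonneg (u : V → ℝ) : 0 ≤ vInner G r u u :=
  Finset.sum_nonneg fun i _ => mul_nonneg (mul_self_nonneg _) (deg_rpow_nonneg G r i)

theorem vNorm_sq (u : V → ℝ) : vNorm G r u ^ 2 = vInner G r u u :=
  Real.sq_sqrt (vInner_self_nonneg G r u)

theorem vNorm_sub_comm (u v : V → ℝ) : vNorm G r (u - v) = vNorm G r (v - u) := by
  rw [vNorm, vNorm, ← neg_sub v u]
  simp only [vInner, Pi.neg_apply, neg_mul_neg]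

variable {G r} in
theorem vInner_eq_zero_of_deg_rpow_eq_zero {i : V} (h : deg G i ^ r = 0) (u v : V → ℝ) :
    vInner G r u v = 0 := by
  have := subsingleton_of_deg_rpow_eq_zero h
  exact Finset.sum_eq_zero fun j _ => by rw [Subsingleton.elim j i, h, mul_zero]

theorem deg_rpow_mul_lap (u : V → ℝ) (i : V) :
    deg G i ^ r * lap G r u i = ∑ j, G.w i j * (u i - u j) := by
  change deg G i ^ r * (deg G i ^ (-r) * ∑ j, G.w i j * (u i - u j)) = _
  -- Where `d i ^ r = 0`, the junk value of `d i ^ (-r)` is harmless: all weights at `i` vanish.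
  by_cases h : deg G i ^ r = 0
  · simp [w_eq_zero_of_deg_rpow_eq_zero h]
  · rw [Real.rpow_neg (deg_nonneg G i), mul_inv_cancel_left₀ h]

theorem eInner_comm (p q : V → V → ℝ) : eInner G p q = eInner G q p := by
  simp only [eInner, mul_comm]

theorem eInner_grad (u v : V → ℝ) :
    eInner G (grad G u) (grad G v) =
      1 / 2 * ∑ i, ∑ j, (u j - u i) * (v j - v i) * G.w i j := by
  refine congrArg _ (Finset.sum_congr rfl fun i _ => Finset.sum_congr rfl fun j _ => ?_)
  by_cases h : G.Adj i j
  · simp [grad, h]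
  · simp [w_eq_zero_of_not_adj h]

theorem eInner_grad_eq_vInner_lap (u v : V → ℝ) :
    eInner G (grad G u) (grad G v) = vInner G r (lap G r u) v := by
  set S := ∑ i, ∑ j, G.w i j * (u i - u j) * v i
  have hswap : ∑ i, ∑ j, G.w i j * (u j - u i) * v j = S := by
    rw [Finset.sum_comm]
    exact Finset.sum_congr rfl fun i _ => Finset.sum_congr rfl fun j _ => by rw [G.w_symm]
  have hsplit : ∑ i, ∑ j, (u j - u i) * (v j - v i) * G.w i j =
      ∑ i, ∑ j, G.w i j * (u j - u i) * v j + S := by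
    simp only [S, ← Finset.sum_add_distrib]
    congr! 2
    ring
  have hlap : vInner G r (lap G r u) v = S := by
    refine Finset.sum_congr rfl fun i _ => ?_
    rw [← Finset.sum_mul, ← deg_rpow_mul_lap]
    ring
  rw [eInner_grad, hsplit, hswap, hlap]
  ring

theorem vInner_lap_comm (u v : V → ℝ) :
    vInner G r u (lap G r v) = vInner G r (lap G r u) v := by
  rw [vInner_comm, ← eInner_grad_eq_vInner_lap, ← eInner_grad_eq_vInner_lap, eInner_comm]

theorem vInner_fidOp_comm (u v : V → ℝ) :
    vInner G r u (fidOp μ v) = vInner G r (fidOp μ u) v :=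
  Finset.sum_congr rfl fun i _ => by
    change u i * (μ i * v i) * _ = μ i * u i * v i * _
    ring

variable {G r} in
theorem hasDerivAt_vInner {U U' : ℝ → V → ℝ} {v v' : V → ℝ} {τ : ℝ} (hU : HasDerivAt U v τ)
    (hU' : HasDerivAt U' v' τ) :
    HasDerivAt (fun t => vInner G r (U t) (U' t))
      (vInner G r v (U' τ) + vInner G r (U τ) v') τ := by
  simp only [vInner, ← Finset.sum_add_distrib, ← add_mul]
  exact .fun_sum fun i _ =>
    ((hasDerivAt_pi.mp hU i).mul (hasDerivAt_pi.mp hU' i)).mul_const _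

variable {G r} in
theorem hasDerivAt_half_vInner_self {L : (V → ℝ) →ₗ[ℝ] (V → ℝ)}
    (hL : ∀ x y, vInner G r x (L y) = vInner G r (L x) y) {U : ℝ → V → ℝ} {v : V → ℝ} {τ : ℝ}
    (hU : HasDerivAt U v τ) :
    HasDerivAt (fun t => 1 / 2 * vInner G r (U t) (L (U t))) (vInner G r (L (U τ)) v) τ := by
  have hLU : HasDerivAt (fun t => L (U t)) (L v) τ :=
    L.toContinuousLinearMap.hasFDerivAt.comp_hasDerivAt τ hU
  refine ((hasDerivAt_vInner hU hLU).const_mul (1 / 2)).congr_deriv ?_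
  rw [vInner_comm G r v, hL (U τ) v]
  ring

/-- The real-valued expression of the Ginzburg-Landau energy, which agrees with `energyFid` on
functions with values in `[0,1]`. -/
noncomputable def energyReal (u : V → ℝ) : ℝ :=
  1 / 2 * eInner G (grad G u) (grad G u)
    + 1 / ε * vInner G r (fun i => 1 / 2 * u i * (1 - u i)) 1
    + 1 / 2 * vInner G r (u - f') (fidOp μ (u - f'))

/-- The gradient of `energyReal` with respect to the inner product `vInner`. -/
noncomputable def energyGradient (u : V → ℝ) : V → ℝ :=
  lap G r u + ε⁻¹ • ((fun _ => 1 / 2) - u) + fidOp μ (u - f')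

variable {f'} in
theorem energyFid_eq_coe {u : V → ℝ} (hu : u ∈ vertexFun V (Icc 0 1)) :
    energyFid G r ε μ f' u = (energyReal G r ε μ f' u : EReal) := by
  have hsum : ∑ i, obstacleW (u i) * ((deg G i ^ r : ℝ) : EReal) =
      ((vInner G r (fun i => 1 / 2 * u i * (1 - u i)) 1 : ℝ) : EReal) := by
    let coe : ℝ →+ EReal := ⟨⟨Real.toEReal, EReal.coe_zero⟩, EReal.coe_add⟩
    refine Eq.trans (Finset.sum_congr rfl fun i _ => ?_) (map_sum coe _ _).symm
    rw [obstacleW, if_pos (hu i), Pi.one_apply, mul_one]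
    rfl
  rw [energyFid, hsum, energyReal, EReal.coe_add, EReal.coe_add, EReal.coe_mul (1 / ε)]

variable {ε μ} in
theorem energyReal_nonneg (hε : 0 ≤ ε) (hμ : μ ∈ vertexFun V (Ici 0)) {u : V → ℝ}
    (hu : u ∈ vertexFun V (Icc 0 1)) : 0 ≤ energyReal G r ε μ f' u := by
  have hgrad : 0 ≤ eInner G (grad G u) (grad G u) :=
    mul_nonneg (by norm_num) <| Finset.sum_nonneg fun i _ => Finset.sum_nonneg fun j _ =>
      mul_nonneg (mul_self_nonneg _) (G.w_nonneg i j)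
  have hpot : 0 ≤ vInner G r (fun i => 1 / 2 * u i * (1 - u i)) 1 :=
    Finset.sum_nonneg fun i _ => by
      have := (hu i).1
      have := sub_nonneg.mpr (hu i).2
      have := deg_rpow_nonneg G r i
      simp only [Pi.one_apply]
      positivity
  have hfid : 0 ≤ vInner G r (u - f') (fidOp μ (u - f')) :=
    Finset.sum_nonneg fun i _ => by
      have := mul_nonneg (hμ i) (mul_self_nonneg ((u - f') i))
      rw [show fidOp μ (u - f') i = μ i * (u - f') i from rfl, mul_left_comm]
      exact mul_nonneg this (deg_rpow_nonneg G r i)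
  unfold energyReal
  positivity

theorem contDiff_energyReal {n : WithTop ℕ∞} : ContDiff ℝ n (energyReal G r ε μ f') := by
  have hfid : ∀ u i, fidOp μ u i = μ i * u i := fun _ _ => rfl
  unfold energyReal
  simp only [eInner_grad, vInner, hfid, Pi.sub_apply]
  fun_prop

variable {G r ε μ f'} in
theorem hasDerivAt_energyReal {U : ℝ → V → ℝ} {v : V → ℝ} {τ : ℝ} (hU : HasDerivAt U v τ) :
    HasDerivAt (fun t => energyReal G r ε μ f' (U t))
      (vInner G r (energyGradient G r ε μ f' (U τ)) v) τ := by
  have hgrad : HasDerivAt (fun t => 1 / 2 * eInner G (grad G (U t)) (grad G (U t)))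
      (vInner G r (lap G r (U τ)) v) τ := by
    simpa only [eInner_grad_eq_vInner_lap G r, ← vInner_lap_comm] using
      hasDerivAt_half_vInner_self (vInner_lap_comm G r) hU
  have hpot : HasDerivAt (fun t => vInner G r (fun i => 1 / 2 * U t i * (1 - U t i)) 1)
      (vInner G r ((fun _ => 1 / 2) - U τ) v) τ := by
    refine .fun_sum fun i _ => ?_
    have hUi := hasDerivAt_pi.mp hU i
    have hUi' := ((hUi.const_mul (1 / 2)).mul (hUi.const_sub 1)).mul_const 1
    refine (hUi'.mul_const (deg G i ^ r)).congr_deriv ?_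
    simp only [Pi.sub_apply]
    ring
  have hfid := hasDerivAt_half_vInner_self (vInner_fidOp_comm G r μ) (hU.sub_const f')
  refine ((hgrad.add (hpot.const_mul (1 / ε))).add hfid).congr_deriv ?_
  rw [energyGradient, vInner_add_left, vInner_add_left, vInner_smul_left, one_div]

end Graph

section Obstacle

variable {V : Type*}

theorem mul_sub_nonneg_of_mem_obstacleB {x y β : V → ℝ} (hβ : β ∈ obstacleB x)
    (hy : y ∈ vertexFun V (Icc 0 1)) (i : V) : 0 ≤ β i * (y i - x i) := by
  have hx : x i ∈ Icc (0 : ℝ) 1 := ((mem_obstacleB_iff x β).mp hβ i).1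
  have hsub := (hβ i).2 (y i)
  simp only [indic01, if_pos hx, if_pos (hy i), zero_add] at hsub
  have : -β i * (y i - x i) ≤ 0 := by exact_mod_cast hsub
  linarith

theorem vInner_deriv_eq_zero_of_mem_obstacleB [Fintype V] (G : WeightedGraph V) (r : ℝ)
    {U : ℝ → V → ℝ} {v β : V → ℝ} {τ : ℝ} (hU : HasDerivAt U v τ)
    (hU_mem : ∀ᶠ t in nhds τ, U t ∈ vertexFun V (Icc 0 1)) (hβ : β ∈ obstacleB (U τ)) :
    vInner G r β v = 0 := by
  have hmin : IsLocalMin (fun t => vInner G r β (U t)) τ := by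
    filter_upwards [hU_mem] with t ht
    refine Finset.sum_le_sum fun i _ =>
      mul_le_mul_of_nonneg_right ?_ (deg_rpow_nonneg G r i)
    linarith [mul_sub_nonneg_of_mem_obstacleB hβ ht i]
  have hderiv : HasDerivAt (fun t => vInner G r β (U t)) (vInner G r β v) τ := by
    simpa [vInner] using hasDerivAt_vInner (hasDerivAt_const τ β) hU
  exact hmin.hasDerivAt_eq_zero hderiv

end Obstacle

/-! ### Energy dissipation along solutions -/

section Solution

variable {V : Type*} [Fintype V] {G : WeightedGraph V} {r ε : ℝ} {μ f' : V → ℝ} {a b : ℝ}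

theorem MemL2.intervalIntegrable {v : ℝ → V → ℝ} (hv : MemL2 a b v) (hab : a ≤ b) :
    IntervalIntegrable v volume a b :=
  (intervalIntegrable_iff_integrableOn_Ioo_of_le hab).mpr <|
    .of_eval fun i => (hv i).integrable one_le_two

theorem MemL2.intervalIntegrable_sq {V : Type*} {v : ℝ → V → ℝ} (hv : MemL2 a b v) (hab : a ≤ b)
    (i : V) : IntervalIntegrable (fun t => v t i ^ 2) volume a b :=
  (intervalIntegrable_iff_integrableOn_Ioo_of_le hab).mpr (hv i).integrable_sq

theorem MemL2.intervalIntegrable_vInner_self {v : ℝ → V → ℝ} (hv : MemL2 a b v) (hab : a ≤ b) :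
    IntervalIntegrable (fun t => vInner G r (v t) (v t)) volume a b := by
  simp only [vInner, ← pow_two, ← Finset.sum_fn]
  exact .sum _ fun i _ => (hv.intervalIntegrable_sq hab i).mul_const _

theorem MemL2.vInner_integral_self_le {v : ℝ → V → ℝ} (hv : MemL2 a b v) (hab : a < b) :
    vInner G r (∫ t in a..b, v t) (∫ t in a..b, v t) ≤
      (b - a) * ∫ t in a..b, vInner G r (v t) (v t) := by
  have hsq := hv.intervalIntegrable_sq hab.le
  have hv_int := hv.intervalIntegrable hab.le
  have hv_i : ∀ i, IntervalIntegrable (fun t => v t i) volume a b := fun i =>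
    ⟨hv_int.1.eval i, hv_int.2.eval i⟩
  have heval : ∀ i, (∫ t in a..b, v t) i = ∫ t in a..b, v t i := fun i => by
    simp only [intervalIntegral.integral_of_le hab.le]
    exact eval_integral (fun j => hv_int.1.eval j) i
  simp only [vInner, ← pow_two, heval]
  rw [intervalIntegral.integral_finsetSum fun i _ => (hsq i).mul_const _, Finset.mul_sum]
  refine Finset.sum_le_sum fun i _ => ?_
  rw [intervalIntegral.integral_mul_const, ← mul_assoc]
  exact mul_le_mul_of_nonneg_right (sq_intervalIntegral_le_mul_integral_sq hab (hv_i i) (hsq i))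
    (deg_rpow_nonneg G r i)

theorem IsWeakDeriv.hasWeakDeriv {u v : ℝ → V → ℝ} (h : IsWeakDeriv G r a b u v)
    (hdeg : ∀ i, deg G i ^ r ≠ 0) (hu : IntegrableOn u (Ioo a b))
    (hv : IntegrableOn v (Ioo a b)) : HasWeakDeriv a b u v := by
  classical
  intro ψ hψ hψ_cpt hψ_supp
  have hψu := integrableOn_smul_of_hasCompactSupport hu (hψ.continuous_deriv (by simp))
    hψ_cpt.deriv
  have hψv := integrableOn_smul_of_hasCompactSupport hv hψ.continuous hψ_cpt
  ext i
  let φ : ℝ → V → ℝ := fun t => ψ t • Pi.single i 1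
  have hφ_deriv : deriv φ = fun t => deriv ψ t • Pi.single i 1 := funext fun t =>
    deriv_smul_const (hψ.differentiable (by simp) t) _
  have hφ_vInner : ∀ (x : V → ℝ) (c : ℝ),
      vInner G r x (c • Pi.single i 1) = c * x i * deg G i ^ r := fun x c => by
    simp [vInner, Pi.single_apply, mul_comm]
  have hweak := h φ (hψ.smul contDiff_const) hψ_cpt.smul_right
    ((tsupport_smul_subset_left _ _).trans hψ_supp)
  simp only [hφ_deriv, φ, hφ_vInner, integral_mul_const] at hweak
  rw [← neg_mul] at hweak
  rw [Pi.neg_apply, eval_integral fun j => hψu.eval j, eval_integral fun j => hψv.eval j]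
  exact mul_right_cancel₀ (hdeg i) hweak

theorem energyReal_sub_eq_integral {u v : ℝ → V → ℝ} (hab : a ≤ b)
    (hv : IntervalIntegrable v volume a b)
    (hv_sq : IntervalIntegrable (fun t => vInner G r (v t) (v t)) volume a b)
    (huv : ∀ x ∈ Icc a b, u x = u a + ∫ t in a..x, v t)
    (hflow : ∀ᵐ t, t ∈ Ioo a b → HasDerivAt u (v t) t →
      vInner G r (energyGradient G r ε μ f' (u t)) (v t) = -vInner G r (v t) (v t)) :
    energyReal G r ε μ f' (u a) - energyReal G r ε μ f' (u b) =
      ∫ t in a..b, vInner G r (v t) (v t) := by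
  have hac : AbsolutelyContinuousOnInterval (fun t => energyReal G r ε μ f' (u t)) a b :=
    absolutelyContinuousOnInterval_contDiff_comp (contDiff_energyReal G r ε μ f')
      (absolutelyContinuousOnInterval_of_eq_add_integral hv (by rwa [uIcc_of_le hab]))
  have hderiv : ∀ᵐ t, t ∈ Ioo a b →
      HasDerivAt (fun t => energyReal G r ε μ f' (u t)) (-vInner G r (v t) (v t)) t := by
    filter_upwards [ae_hasDerivAt_of_eq_add_integral hab hv huv, hflow] with t hut hflow_t ht
    rw [← hflow_t ht (hut ht)]
    exact hasDerivAt_energyReal (hut ht)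
  have hftc := integral_eq_sub_of_ae_hasDerivAt hab hac hv_sq.neg hderiv
  simp only [Pi.neg_apply] at hftc
  rw [intervalIntegral.integral_neg] at hftc
  linarith

variable {T : Set ℝ} {u β : ℝ → V → ℝ}

theorem vInner_energyGradient_eq_neg {x v β : V → ℝ} (hε : ε ≠ 0)
    (hACE : ε • v + ε • opA G r μ x - ε • fidOp μ f' + (fun _ => 1 / 2) - x = β)
    (hβv : vInner G r β v = 0) :
    vInner G r (energyGradient G r ε μ f' x) v = -vInner G r v v := by
  have hgrad : energyGradient G r ε μ f' x = ε⁻¹ • β - v := by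
    rw [← hACE, energyGradient, map_sub, opA, LinearMap.add_apply]
    ext i
    simp only [Pi.add_apply, Pi.sub_apply, Pi.smul_apply, smul_eq_mul]
    field_simp
    ring
  rw [hgrad, vInner_sub_left, vInner_smul_left, hβv, mul_zero, zero_sub]

theorem IsACESolution.vNorm_sub_sq_le_of_deg_rpow_ne_zero (hu : IsACESolution G r ε μ f' T u β)
    (hε : ε ≠ 0) (hdeg : ∀ i, deg G i ^ r ≠ 0) (hT : T.OrdConnected) (ha : a ∈ T) (hb : b ∈ T)
    (hab : a < b) :
    vNorm G r (u a - u b) ^ 2 ≤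
      (b - a) * (energyReal G r ε μ f' (u a) - energyReal G r ε μ f' (u b)) := by
  obtain ⟨hu_mem, hu_cont, v, hH1, hACE⟩ := hu
  obtain ⟨-, hv, hweak⟩ := hH1 a ha b hb
  have hIccT : Icc a b ⊆ T := hT.out ha hb
  have hIooT : Ioo a b ⊆ T := Ioo_subset_Icc_self.trans hIccT
  have hu_cont' : ContinuousOn u (Icc a b) := hu_cont.mono hIccT
  have hv_int := hv.intervalIntegrable hab.le
  have huv : ∀ x ∈ Icc a b, u x = u a + ∫ t in a..x, v t :=
    (hweak.hasWeakDeriv hdeg (hu_cont'.integrableOn_Icc.mono_set Ioo_subset_Icc_self)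
      ((intervalIntegrable_iff_integrableOn_Ioo_of_le hab.le).mp hv_int)).eq_add_integral hab
      hu_cont' hv_int
  have hflow : ∀ᵐ t, t ∈ Ioo a b → HasDerivAt u (v t) t →
      vInner G r (energyGradient G r ε μ f' (u t)) (v t) = -vInner G r (v t) (v t) := by
    rw [ae_restrict_iff' hT.measurableSet] at hACE
    filter_upwards [hACE] with t hACE_t ht hut
    obtain ⟨heq, hβ⟩ := hACE_t (hIooT ht)
    refine vInner_energyGradient_eq_neg hε heq
      (vInner_deriv_eq_zero_of_mem_obstacleB G r hut ?_ hβ)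
    filter_upwards [isOpen_Ioo.mem_nhds ht] with y hy using hu_mem y (hIooT hy)
  have hsub : u b - u a = ∫ t in a..b, v t := by
    rw [huv b (right_mem_Icc.mpr hab.le), add_sub_cancel_left]
  rw [vNorm_sub_comm, vNorm_sq, hsub, energyReal_sub_eq_integral hab.le hv_int
    (hv.intervalIntegrable_vInner_self hab.le) huv hflow]
  exact hv.vInner_integral_self_le hab

theorem IsACESolution.vNorm_sub_sq_le (hu : IsACESolution G r ε μ f' T u β)
    (hε : ε ≠ 0) (hT : T.OrdConnected) (ha : a ∈ T) (hb : b ∈ T) (hab : a < b) :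
    vNorm G r (u a - u b) ^ 2 ≤
      (b - a) * (energyReal G r ε μ f' (u a) - energyReal G r ε μ f' (u b)) := by
  by_cases hdeg : ∀ i, deg G i ^ r ≠ 0
  · exact hu.vNorm_sub_sq_le_of_deg_rpow_ne_zero hε hdeg hT ha hb hab
  · push Not at hdeg
    obtain ⟨i, hi⟩ := hdeg
    simp [vNorm_sq, energyReal, eInner_grad_eq_vInner_lap G r,
      vInner_eq_zero_of_deg_rpow_eq_zero hi]

theorem IsACESolution.antitoneOn_energyReal (hu : IsACESolution G r ε μ f' T u β) (hε : ε ≠ 0)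
    (hT : T.OrdConnected) : AntitoneOn (fun t => energyReal G r ε μ f' (u t)) T := by
  intro s hs t ht hst
  rcases hst.eq_or_lt with rfl | hst
  · exact le_rfl
  · have hdrop := (sq_nonneg _).trans (hu.vNorm_sub_sq_le hε hT hs ht hst)
    exact sub_nonneg.mp (nonneg_of_mul_nonneg_right hdrop (sub_pos.mpr hst))

theorem IsACESolution.vNorm_sub_le (hu : IsACESolution G r ε μ f' T u β) (hε : 0 < ε)
    (hμ : μ ∈ vertexFun V (Ici 0)) (hT : T.OrdConnected) (ha : IsLeast T a) {s t : ℝ}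
    (hs : s ∈ T) (ht : t ∈ T) :
    vNorm G r (u s - u t) ≤ √|t - s| * √(energyReal G r ε μ f' (u a)) := by
  wlog hst : s ≤ t generalizing s t
  · rw [vNorm_sub_comm, abs_sub_comm]
    exact this ht hs (le_of_not_ge hst)
  rcases hst.eq_or_lt with rfl | hst
  · simp [vNorm, vInner]
  have hpos : 0 < t - s := sub_pos.mpr hst
  have hanti := hu.antitoneOn_energyReal hε.ne' hT ha.1 hs (ha.2 hs)
  have hnonneg := energyReal_nonneg G r f' hε.le hμ (hu.1 t ht)
  rw [abs_of_pos hpos, ← Real.sqrt_mul hpos.le]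
  refine Real.le_sqrt_of_sq_le ((hu.vNorm_sub_sq_le hε.ne' hT hs ht hst).trans ?_)
  gcongr
  exact (sub_le_self _ hnonneg).trans hanti

theorem ordConnected_and_isLeast_zero
    (hT : T = Ici 0 ∨ ∃ T₀ : ℝ, 0 < T₀ ∧ T = Icc 0 T₀) : T.OrdConnected ∧ IsLeast T 0 := by
  rcases hT with rfl | ⟨T₀, hT₀, rfl⟩
  · exact ⟨ordConnected_Ici, isLeast_Ici⟩
  · exact ⟨ordConnected_Icc, isLeast_Icc hT₀.le⟩

end Solution

end GraphACE

theorem theorem2p15_general {V : Type*} [Fintype V] (G : GraphACE.WeightedGraph V)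
    (r ε : ℝ) (hε : 0 < ε) (μ : V → ℝ) (hμ : μ ∈ GraphACE.vertexFun V (Set.Ici 0)) (f' : V → ℝ)
    (T : Set ℝ) (hT : T.OrdConnected) (a : ℝ) (ha : IsLeast T a)
    (u β : ℝ → V → ℝ) (hu : GraphACE.IsACESolution G r ε μ f' T u β) :
    (∀ t ∈ T, GraphACE.energyFid G r ε μ f' (u t) ≠ ⊤ ∧
      GraphACE.energyFid G r ε μ f' (u t) ≠ ⊥) ∧
    AntitoneOn (fun t => GraphACE.energyFid G r ε μ f' (u t)) T ∧
    (∀ s ∈ T, ∀ t ∈ T, s < t →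
      GraphACE.energyFid G r ε μ f' (u s) - GraphACE.energyFid G r ε μ f' (u t) ≥
        ((1 / (2 * (t - s)) * GraphACE.vNorm G r (u s - u t) ^ 2 : ℝ) : EReal)) ∧
    (∀ s ∈ T, ∀ t ∈ T,
      GraphACE.vNorm G r (u s - u t) ≤
        Real.sqrt |t - s| *
          Real.sqrt (2 * (GraphACE.energyFid G r ε μ f' (u a)).toReal)) := by
  have hcoe : ∀ t ∈ T, GraphACE.energyFid G r ε μ f' (u t) =
      (GraphACE.energyReal G r ε μ f' (u t) : EReal) := fun t ht =>
    GraphACE.energyFid_eq_coe G r ε μ (hu.1 t ht)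
  refine ⟨fun t ht => ?_, fun s hs t ht hst => ?_, fun s hs t ht hst => ?_, fun s hs t ht => ?_⟩
  · simp [hcoe t ht]
  · simpa only [hcoe s hs, hcoe t ht, EReal.coe_le_coe_iff] using
      hu.antitoneOn_energyReal hε.ne' hT hs ht hst
  · rw [hcoe s hs, hcoe t ht, ← EReal.coe_sub, ge_iff_le, EReal.coe_le_coe_iff,
      one_div_mul_eq_div, div_le_iff₀' (mul_pos two_pos (sub_pos.mpr hst))]
    linarith [hu.vNorm_sub_sq_le hε.ne' hT hs ht hst,
      sq_nonneg (GraphACE.vNorm G r (u s - u t))]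
  · rw [hcoe a ha.1, EReal.toReal_coe]
    refine (hu.vNorm_sub_le hε hμ hT ha hs ht).trans ?_
    gcongr
    linarith [GraphACE.energyReal_nonneg G r f' hε.le hμ (hu.1 a ha.1)]

theorem theorem2p15 {V : Type*} [Fintype V] (G : GraphACE.WeightedGraph V)
    (r : ℝ) (hr : r ∈ Set.Icc (0 : ℝ) 1) (ε : ℝ) (hε : 0 < ε)
    (μ : V → ℝ) (hμ : μ ∈ GraphACE.vertexFun V (Set.Ici 0)) (hμ0 : μ ≠ 0)
    (f' : V → ℝ) (hf' : f' ∈ GraphACE.vertexFun V (Set.Icc 0 1))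
    (hσ : ε⁻¹ ∉ GraphACE.eigenvalueSet (GraphACE.opA G r μ))
    (T : Set ℝ) (hT : T = Set.Ici 0 ∨ ∃ T₀ : ℝ, 0 < T₀ ∧ T = Set.Icc 0 T₀)
    (u β : ℝ → V → ℝ) (hu : GraphACE.IsACESolution G r ε μ f' T u β) :
    (∀ t ∈ T, GraphACE.energyFid G r ε μ f' (u t) ≠ ⊤ ∧
      GraphACE.energyFid G r ε μ f' (u t) ≠ ⊥) ∧
    AntitoneOn (fun t => GraphACE.energyFid G r ε μ f' (u t)) T ∧
    (∀ s ∈ T, ∀ t ∈ T, s < t →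
      GraphACE.energyFid G r ε μ f' (u s) - GraphACE.energyFid G r ε μ f' (u t) ≥
        ((1 / (2 * (t - s)) * GraphACE.vNorm G r (u s - u t) ^ 2 : ℝ) : EReal)) ∧
    (∀ s ∈ T, ∀ t ∈ T,
      GraphACE.vNorm G r (u s - u t) ≤
        Real.sqrt |t - s| *
          Real.sqrt (2 * (GraphACE.energyFid G r ε μ f' (u 0)).toReal)) := by
  obtain ⟨hT_conn, hT_least⟩ := GraphACE.ordConnected_and_isLeast_zero hT
  exact theorem2p15_general G r ε hε μ hμ f' T hT_conn 0 hT_least u β hu
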